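/- For a complex number $x$ and integers $\ell \ge 1$, $m\ge 0$ put $$H_m^{\langle \ell\rangle}(x)=\sum_{k=1}^m\frac{1}{(x+k)^\ell},\qquad H_m(x)=H_m^{\langle 1\rangle}(x),\qquad \binom{x}{m}=\frac{x(x-1)\cdots(x-m+1)}{m!}.$$ Let $n\ge 2$ be an integer and let $x$ be a complex number with $x\notin\{-1,-2,\dots,-(2n+1)\}$ and $xn+3n+1\neq 0$ (so that no denominator below vanishes). Then $$\begin{aligned} \sum_{k=0}^n\binom{2n-k}{n}\binom{x+k}{k}k^2H_k(x)^2 ={}&\frac{(x+1)(xn+3n+1)}{8(n-1)}\binom{x+2n+1}{n-2}\\ &\times\Big\{8\big[H_{n+3}(x)-H_{2n+1}(x)\big]\Big[H_{n+3}(x)-H_{2n+1}(x)-\frac{2(2xn+4n+1)}{(x+1)(xn+3n+1)}\Big]\\ &\quad-\Big[H_n\big(\tfrac{x}{2}\big)-H_{n+1}\big(\tfrac{x-1}{2}\big)\Big]\Big[H_n\big(\tfrac{x}{2}\big)-H_{n+1}\big(\tfrac{x-1}{2}\big)-\frac{4(x+n+1)(x^2+3x-2n+1)}{n(x+1)(xn+3n+1)}\Big]\\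 &\quad+8H_{n+3}^{\langle 2\rangle}(x)-4H_{2n+1}^{\langle 2\rangle}(x)+\frac{8(x^2+3x+3n^2-n+1)}{n(x+1)(xn+3n+1)}\Big\}. \end{aligned}$$ -/

import Mathlib

/-- The generalized harmonic number of order `ℓ`:
`H_n^{⟨ℓ⟩}(x) = ∑_{k=1}^n 1 / (x + k)^ℓ`, which is `0` for `n = 0`. -/
noncomputable def genHarmonicOrd (ℓ n : ℕ) (x : ℂ) : ℂ :=
  ∑ k ∈ Finset.Icc 1 n, 1 / (x + (k : ℂ)) ^ ℓ

/-- The generalized harmonic number (of order one) `H_n(x) = ∑_{k=1}^n 1 / (x + k)`. -/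
noncomputable def genHarmonic (n : ℕ) (x : ℂ) : ℂ :=
  genHarmonicOrd 1 n x

/-!
Each derivative in `x` turns `binom (x + k) k` into `binom (x + k) k * H_k(x)`, and then into
`binom (x + k) k * (H_k(x) ^ 2 - H_k^{⟨2⟩}(x))`. The second moment of the weights
`binom (2n - k) n * binom (x + k) k` is
`(x + 1) (xn + 3n + 1) / (n - 1) * binom (x + 2n + 1) (n - 2)`, so differentiating it twice
evaluates the sum with `H_k² - H_k^{⟨2⟩}` and produces the terms in `H_{2n+1} - H_{n+3}`.

The remaining sum, with `k² H_k^{⟨2⟩}`, is reduced by a summation by parts to the sums of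
`H_k^{⟨2⟩}` and of `1 / (x + k + 1)`. For any sequence `g`, the weighted sum satisfies a first-order
recurrence in `n` whose inhomogeneous part only involves the differences of `g`. It gives, up to
the factor `binom (x + 2n + 1) n`, an alternating harmonic sum `A` for `1 / (x + k + 1)`, and from
this `(H_{2n+1}^{⟨2⟩} - A²) / 2` for `H_k^{⟨2⟩}`.
-/

open Finset Filter Topology

lemma sub_mul_choose_add_sub {R : Type*} [CommRing R] {m N k : ℕ} (hk : k ≤ N) :
    ((N : R) - k) * ((m + N - k).choose m : R)
      = ((m : R) + N - k) * ((m + N - (k + 1)).choose m : R) := by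
  obtain ⟨d, rfl⟩ := Nat.exists_eq_add_of_le hk
  rcases d with _ | d
  · rcases m with _ | m
    · simp
    · simp [show m + 1 + k - (k + 1) = m by omega]
  · have h := Nat.choose_mul_succ_eq (m + d) m
    rw [show m + d + 1 - m = d + 1 by omega] at h
    rw [show m + (k + (d + 1)) - (k + 1) = m + d by omega,
      show m + (k + (d + 1)) - k = m + d + 1 by omega]
    have h' : ((m + d).choose m : R) * (m + d + 1) = ((m + d + 1).choose m : R) * (d + 1) := by
      exact_mod_cast congrArg (Nat.cast : ℕ → R) h
    push_cast
    linear_combination -h'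

section BinomialRing

variable {R : Type*} [CommRing R] [BinomialRing R]

lemma succ_mul_ringChoose_succ (r : R) (k : ℕ) :
    ((k : R) + 1) * Ring.choose r (k + 1) = (r - k) * Ring.choose r k := by
  have h := Ring.choose_smul_choose r (Nat.le_succ k)
  simp only [Nat.succ_eq_add_one, Nat.choose_succ_self_right, Nat.add_sub_cancel_left,
    Ring.choose_one_right, nsmul_eq_mul, Nat.cast_add, Nat.cast_one] at h
  rw [h, mul_comm]

lemma succ_mul_ringChoose_succ_succ (r : R) (k : ℕ) :
    ((k : R) + 1) * Ring.choose (r + 1) (k + 1) = (r + 1) * Ring.choose r k := by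
  simpa using Ring.choose_add_smul_choose r k 1

lemma sub_mul_ringChoose_add_one (r : R) (k : ℕ) :
    (r + 1 - k) * Ring.choose (r + 1) k = (r + 1) * Ring.choose r k := by
  rw [← succ_mul_ringChoose_succ, succ_mul_ringChoose_succ_succ]

lemma succ_mul_ringChoose_add_succ (x : R) (k : ℕ) :
    ((k : R) + 1) * Ring.choose (x + (k + 1 : ℕ)) (k + 1)
      = (x + k + 1) * Ring.choose (x + k) k := by
  rw [Nat.cast_succ, ← add_assoc, succ_mul_ringChoose_succ_succ]

lemma ringChoose_two_mul_succ (x : R) (n : ℕ) :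
    ((n : R) + 1) * (x + n + 2) * Ring.choose (x + 2 * (n + 1 : ℕ) + 1) (n + 1)
      = (x + 2 * n + 2) * (x + 2 * n + 3) * Ring.choose (x + 2 * n + 1) n := by
  have h1 := succ_mul_ringChoose_succ_succ (x + 2 * n + 1 + 1) n
  have h2 := sub_mul_ringChoose_add_one (x + 2 * n + 1) n
  have e : x + 2 * ((n + 1 : ℕ) : R) + 1 = x + 2 * n + 1 + 1 + 1 := by push_cast; ring
  rw [e]
  linear_combination (x + n + 2) * h1 + (x + 2 * n + 3) * h2

/-- The hypergeometric term `binom (m + N - k) m * binom (x + k) k`, whose case `m = N = n` is the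
summand in the theorem; it is meant for `k ≤ N`, where `m + N - k` is not truncated below `m`. -/
noncomputable def chooseWeight (m N : ℕ) (x : R) (k : ℕ) : R :=
  ((m + N - k).choose m : R) * Ring.choose (x + k) k

lemma chooseWeight_zero (m N : ℕ) (x : R) : chooseWeight m N x 0 = ((m + N).choose m : R) := by
  simp [chooseWeight]

lemma mul_chooseWeight_succ_self (m N : ℕ) (x : R) :
    (m : R) * chooseWeight m N x (N + 1) = 0 := by
  rcases m with _ | m
  · simp
  · simp [chooseWeight, show m + 1 + N - (N + 1) = m by omega]

lemma chooseWeight_succ (x : R) {m N k : ℕ} (hk : k ≤ N) :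
    ((k : R) + 1) * (m + N - k) * chooseWeight m N x (k + 1)
      = (N - k) * (x + k + 1) * chooseWeight m N x k := by
  have h1 := sub_mul_choose_add_sub (R := R) (m := m) hk
  have h2 := succ_mul_ringChoose_add_succ x k
  simp only [chooseWeight]
  linear_combination (m + N - k) * ((m + N - (k + 1)).choose m : R) * h2
    - (x + k + 1) * Ring.choose (x + k) k * h1

lemma chooseWeight_diagonal_succ_zero (n : ℕ) (x : R) :
    ((n : R) + 1) * chooseWeight (n + 1) (n + 1) x 0 = 2 * (2 * n + 1) * chooseWeight n n x 0 := by
  have h := congrArg (Nat.cast : ℕ → R) (Nat.succ_mul_centralBinom_succ n)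
  simpa [Nat.centralBinom, two_mul, chooseWeight_zero] using h

lemma chooseWeight_diagonal_succ_succ (x : R) {n k : ℕ} (hk : k ≤ n) :
    ((n : R) + 1) * (x + n + 2) * chooseWeight (n + 1) (n + 1) x (k + 1)
      = (2 * n - k) * (2 * x + 2 * n + k + 5) * chooseWeight n n x (k + 1)
        + (x + k + 1) * (x + k + 2) * chooseWeight n n x k := by
  have h1 := sub_mul_choose_add_sub (R := R) (m := n) hk
  have h2 := succ_mul_ringChoose_add_succ x k
  have h3 : ((n : R) + n - k + 1) * ((n + n - k).choose n : R)
      = ((n + 1 + (n + 1) - (k + 1)).choose (n + 1) : R) * (n + 1) := by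
    have h := congrArg (Nat.cast : ℕ → R) (Nat.add_one_mul_choose_eq (n + n - k) n)
    rw [show n + 1 + (n + 1) - (k + 1) = n + n - k + 1 by omega]
    push_cast [Nat.cast_sub (show k ≤ n + n by omega)] at h
    exact h
  simp only [chooseWeight]
  linear_combination -(x + n + 2) * Ring.choose (x + (k + 1 : ℕ)) (k + 1) * h3
    + (2 * x + 2 * n + k + 5) * Ring.choose (x + (k + 1 : ℕ)) (k + 1) * h1
    + (x + k + 2) * ((n + n - k).choose n : R) * h2

/-- The sum of `g` against the weights `chooseWeight m N x`, the functional through which all sums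
of the theorem are expressed. -/
noncomputable def chooseConv (m N : ℕ) (x : R) (g : ℕ → R) : R :=
  ∑ k ∈ range (N + 1), chooseWeight m N x k * g k

lemma chooseConv_congr {m N : ℕ} {x : R} {f g : ℕ → R} (h : ∀ k ≤ N, f k = g k) :
    chooseConv m N x f = chooseConv m N x g :=
  sum_congr rfl fun k hk => by rw [h k (mem_range_succ_iff.1 hk)]

lemma chooseConv_add (m N : ℕ) (x : R) (f g : ℕ → R) :
    chooseConv m N x (fun k => f k + g k) = chooseConv m N x f + chooseConv m N x g := by
  simp only [chooseConv, mul_add, sum_add_distrib]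

lemma chooseConv_const_mul (m N : ℕ) (x c : R) (f : ℕ → R) :
    chooseConv m N x (fun k => c * f k) = c * chooseConv m N x f := by
  simp only [chooseConv, mul_sum, mul_left_comm c]

lemma chooseConv_by_parts (m N : ℕ) (x : R) (g : ℕ → R) :
    chooseConv m N x (fun k => ((N : R) - k) * (x + k + 1) * g (k + 1))
      = chooseConv m N x (fun k => k * ((m : R) + N + 1 - k) * g k) := by
  let v : ℕ → R := fun k => k * (m + N + 1 - k) * chooseWeight m N x k * g k
  have hlast : v (N + 1) = 0 := by
    simp only [v]
    push_cast
    linear_combination (N + 1) * g (N + 1) * mul_chooseWeight_succ_self m N x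
  have hsum := sum_range_sub v (N + 1)
  rw [hlast, show v 0 = 0 by simp [v], sub_zero] at hsum
  rw [← sub_eq_zero, ← hsum, chooseConv, chooseConv, ← sum_sub_distrib]
  refine sum_congr rfl fun k hk => ?_
  have h := chooseWeight_succ x (m := m) (mem_range_succ_iff.1 hk)
  simp only [v]
  push_cast
  linear_combination -g (k + 1) * h

lemma chooseConv_id (m N : ℕ) (x : R) :
    (x + m + 2) * chooseConv m N x (fun k => (k : R))
      = N * (x + 1) * chooseConv m N x (fun _ => 1) := by
  have h := chooseConv_by_parts m N x (fun _ => 1)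
  rw [← chooseConv_const_mul, ← chooseConv_const_mul, ← sub_eq_zero]
  rw [← sub_eq_zero] at h
  rw [← neg_eq_zero, ← h]
  simp only [chooseConv, ← sum_sub_distrib, ← sum_neg_distrib]
  exact sum_congr rfl fun k _ => by ring

/-- The linear factor `(x + m + 2) * k + N * (x + 2) - (x + 1)` inserted in the summation by parts
is the one which eliminates the first moment of `h`. -/
lemma chooseConv_sq_mul (m N : ℕ) (x : R) (h : ℕ → R) :
    (x + m + 2) * (x + m + 3) * chooseConv m N x (fun k => (k : R) ^ 2 * h k)
      = N * (x + 1) * (x * N + 2 * N + m + 1) * chooseConv m N x h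
        + chooseConv m N x (fun k => ((N : R) - k)
            * ((x + m + 2) * (k + 1) + N * (x + 2) - (x + 1))
            * ((x + k + 1) * (h (k + 1) - h k))) := by
  have key := chooseConv_by_parts m N x
    (fun k => ((x + m + 2) * k + N * (x + 2) - (x + 1)) * h k)
  rw [← sub_eq_zero] at key
  rw [← chooseConv_const_mul, ← chooseConv_const_mul, ← chooseConv_add, ← sub_eq_zero,
    ← neg_eq_zero, ← key]
  simp only [chooseConv, ← sum_sub_distrib, ← sum_neg_distrib]
  refine sum_congr rfl fun k _ => ?_
  push_cast
  ring

lemma chooseConv_diagonal_succ (n : ℕ) (x : R) (g : ℕ → R) :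
    ((n : R) + 1) * (x + n + 2) * chooseConv (n + 1) (n + 1) x g
      = (x + 2 * n + 2) * (x + 2 * n + 3) * chooseConv n n x g
        + chooseConv n n x (fun k => (x + k + 1) * (x + k + 2) * (g (k + 1) - g k)) := by
  -- Summing by parts works because `(x + 2n + 2) (x + 2n + 3)` equals
  -- `(2n + 1 - k) (2x + 2n + k + 4) + (x + k + 1) (x + k + 2)` for every `k`.
  let u : ℕ → R := fun k => (2 * n + 1 - k) * (2 * x + 2 * n + k + 4) * chooseWeight n n x k * g k
  have hlast : u (n + 1) = 0 := by
    simp only [u]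
    push_cast
    linear_combination (2 * x + 3 * n + 5) * g (n + 1) * mul_chooseWeight_succ_self n n x
  have hu : ∑ k ∈ range (n + 1), u k = ∑ k ∈ range (n + 1), u (k + 1) + u 0 := by
    rw [← sum_range_succ', sum_range_succ _ (n + 1), hlast, add_zero]
  calc ((n : R) + 1) * (x + n + 2) * chooseConv (n + 1) (n + 1) x g
    _ = ∑ k ∈ range (n + 1), (u (k + 1)
          + (x + k + 1) * (x + k + 2) * chooseWeight n n x k * g (k + 1)) + u 0 := by
      rw [chooseConv, sum_range_succ', mul_add, mul_sum]
      congr 1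
      · refine sum_congr rfl fun k hk => ?_
        simp only [u]
        push_cast
        linear_combination g (k + 1) *
          chooseWeight_diagonal_succ_succ x (mem_range_succ_iff.1 hk)
      · simp only [u, Nat.cast_zero]
        linear_combination (x + n + 2) * g 0 * chooseWeight_diagonal_succ_zero n x
    _ = ∑ k ∈ range (n + 1), (u k
          + (x + k + 1) * (x + k + 2) * chooseWeight n n x k * g (k + 1)) := by
      rw [sum_add_distrib, sum_add_distrib, hu]
      ring
    _ = _ := by
      rw [← chooseConv_const_mul]
      simp only [chooseConv, ← sum_add_distrib, u]
      exact sum_congr rfl fun k _ => by ring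

lemma ringChoose_neg_add_one (r : R) (k : ℕ) :
    Ring.choose (-(r + 1)) k = (-1) ^ k * Ring.choose (r + k) k := by
  rw [Ring.choose_neg, add_right_comm, add_sub_cancel_right, Units.smul_def, Int.negOnePow_def]
  simp

lemma chooseConv_one (m N : ℕ) (x : R) :
    chooseConv m N x (fun _ => 1) = Ring.choose (x + m + N + 1) N := by
  have hvandermonde := Ring.add_choose_eq N (Commute.all (-(x + 1)) (-((m : R) + 1)))
  rw [show -(x + 1) + -((m : R) + 1) = -(x + m + 1 + 1) by ring, ringChoose_neg_add_one,
    Finset.Nat.sum_antidiagonal_eq_sum_range_succ_mk,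
    show x + m + 1 + N = x + m + N + 1 by ring] at hvandermonde
  apply ((isUnit_one.neg).pow N).mul_left_cancel
  rw [hvandermonde, chooseConv, mul_sum]
  refine sum_congr rfl fun k hk => ?_
  obtain ⟨d, rfl⟩ := Nat.exists_eq_add_of_le (mem_range_succ_iff.1 hk)
  rw [Nat.add_sub_cancel_left, ringChoose_neg_add_one, ringChoose_neg_add_one, ← Nat.cast_add,
    Ring.choose_natCast, chooseWeight, show m + (k + d) - k = m + d by omega,
    Nat.choose_symm_add, pow_add]
  ring

lemma chooseConv_diagonal_one (n : ℕ) (x : R) :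
    chooseConv n n x (fun _ => 1) = Ring.choose (x + 2 * n + 1) n := by
  rw [chooseConv_one, add_assoc x, ← two_mul]

lemma ringChoose_two_mul_sub_two (x : R) {n : ℕ} (hn : 2 ≤ n) :
    (x + n + 2) * (x + n + 3) * Ring.choose (x + 2 * n + 1) (n - 2)
      = n * (n - 1) * Ring.choose (x + 2 * n + 1) n := by
  obtain ⟨m, rfl⟩ := Nat.exists_eq_add_of_le' hn
  have h1 := succ_mul_ringChoose_succ (x + 2 * (m + 2 : ℕ) + 1) m
  have h2 := succ_mul_ringChoose_succ (x + 2 * (m + 2 : ℕ) + 1) (m + 1)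
  rw [Nat.add_sub_cancel]
  push_cast at h1 h2 ⊢
  linear_combination -(x + m + 4) * h1 - (m + 1) * h2

lemma chooseConv_diagonal_sq [NoZeroDivisors R] {x : R} {n : ℕ} (hn : 2 ≤ n)
    (h2 : x + n + 2 ≠ 0) (h3 : x + n + 3 ≠ 0) :
    ((n : R) - 1) * chooseConv n n x (fun k => (k : R) ^ 2)
      = Ring.choose (x + 2 * n + 1) (n - 2) * ((x + 1) * (x * n + 3 * n + 1)) := by
  have hsq := chooseConv_sq_mul n n x (fun _ => 1)
  simp only [mul_one, sub_self, mul_zero, chooseConv_diagonal_one] at hsq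
  rw [show chooseConv n n x (fun _ => 0) = 0 by simp [chooseConv], add_zero] at hsq
  apply mul_left_cancel₀ (mul_ne_zero h2 h3)
  linear_combination (n - 1) * hsq
    - (x + 1) * (x * n + 3 * n + 1) * ringChoose_two_mul_sub_two x hn

lemma chooseConv_diagonal_eq_of_succ [NoZeroDivisors R] {x : R} {g S : ℕ → R} {n : ℕ}
    (hx : ∀ i < n, x + i + 2 ≠ 0) (h0 : g 0 = S 0)
    (hsucc : ∀ i < n,
      chooseConv i i x (fun k => (x + k + 1) * (x + k + 2) * (g (k + 1) - g k))
        = Ring.choose (x + 2 * i + 1) i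
            * ((x + 2 * i + 2) * (x + 2 * i + 3) * (S (i + 1) - S i))) :
    chooseConv n n x g = Ring.choose (x + 2 * n + 1) n * S n := by
  induction n with
  | zero => simp [chooseConv, chooseWeight, h0]
  | succ n ih =>
    have := BinomialRing.toIsAddTorsionFree (R := R)
    have hrec := chooseConv_diagonal_succ n x g
    have hbinom := ringChoose_two_mul_succ x n
    rw [hsucc n n.lt_succ_self, ih (fun i hi => hx i (hi.trans n.lt_succ_self)) fun i hi =>
      hsucc i (hi.trans n.lt_succ_self)] at hrec
    apply mul_left_cancel₀ (hx n n.lt_succ_self)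
    apply nsmul_right_injective n.succ_ne_zero
    simp only [nsmul_eq_mul, Nat.succ_eq_add_one]
    push_cast at hbinom ⊢
    linear_combination hrec - S (n + 1) * hbinom

end BinomialRing

lemma genHarmonicOrd_zero (ℓ : ℕ) (x : ℂ) : genHarmonicOrd ℓ 0 x = 0 := by
  simp [genHarmonicOrd]

lemma genHarmonicOrd_succ (ℓ n : ℕ) (x : ℂ) :
    genHarmonicOrd ℓ (n + 1) x = genHarmonicOrd ℓ n x + 1 / (x + n + 1) ^ ℓ := by
  simp [genHarmonicOrd, sum_Icc_succ_top, add_assoc]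

lemma genHarmonic_zero (x : ℂ) : genHarmonic 0 x = 0 :=
  genHarmonicOrd_zero 1 x

lemma genHarmonic_succ (n : ℕ) (x : ℂ) :
    genHarmonic (n + 1) x = genHarmonic n x + 1 / (x + n + 1) := by
  simp only [genHarmonic, genHarmonicOrd_succ, pow_one]

/-- The alternating harmonic sum `∑_{j=1}^N (-1)^(j+1) / (x + j)`; for `N = 2 * n + 1` it is, up to
the factor `-2`, the difference of harmonic numbers at `x / 2` and `(x - 1) / 2`. -/
noncomputable def altHarmonic (N : ℕ) (x : ℂ) : ℂ :=
  ∑ j ∈ Icc 1 N, (-1) ^ (j + 1) / (x + j)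

lemma altHarmonic_one (x : ℂ) : altHarmonic 1 x = 1 / (x + 1) := by
  simp [altHarmonic]

lemma altHarmonic_odd_succ (n : ℕ) (x : ℂ) :
    altHarmonic (2 * (n + 1) + 1) x
      = altHarmonic (2 * n + 1) x - 1 / (x + 2 * n + 2) + 1 / (x + 2 * n + 3) := by
  have hodd : (-1 : ℂ) ^ (2 * n + 1 + 1 + 1) = -1 := Odd.neg_one_pow ⟨n + 1, by ring⟩
  have heven : (-1 : ℂ) ^ (2 * n + 1 + 1 + 1 + 1) = 1 := Even.neg_one_pow ⟨n + 2, by ring⟩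
  rw [show 2 * (n + 1) + 1 = 2 * n + 1 + 1 + 1 by ring, altHarmonic, sum_Icc_succ_top (by omega),
    sum_Icc_succ_top (by omega), ← altHarmonic, hodd, heven]
  push_cast
  ring

lemma genHarmonic_half_sub_genHarmonic_half (n : ℕ) (x : ℂ) :
    genHarmonic n (x / 2) - genHarmonic (n + 1) ((x - 1) / 2) = -2 * altHarmonic (2 * n + 1) x := by
  have hhalf (y : ℂ) : 1 / (y / 2) = 2 * (1 / y) := by rw [one_div_div, mul_one_div]
  induction n with
  | zero =>
    rw [genHarmonic_succ, genHarmonic_zero, genHarmonic_zero, altHarmonic_one,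
      show (x - 1) / 2 + (0 : ℕ) + 1 = (x + 1) / 2 by push_cast; ring, hhalf]
    ring
  | succ n ih =>
    rw [genHarmonic_succ, genHarmonic_succ (n + 1), altHarmonic_odd_succ,
      show x / 2 + n + 1 = (x + 2 * n + 2) / 2 by ring,
      show (x - 1) / 2 + (n + 1 : ℕ) + 1 = (x + 2 * n + 3) / 2 by push_cast; ring, hhalf, hhalf]
    linear_combination ih

section OrderTwo

variable {x : ℂ} {n : ℕ}

lemma chooseConv_diagonal_one_div (hx : ∀ j ∈ Icc 1 (2 * n + 1), x + j ≠ 0) :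
    chooseConv n n x (fun k => 1 / (x + k + 1))
      = Ring.choose (x + 2 * n + 1) n * altHarmonic (2 * n + 1) x := by
  refine chooseConv_diagonal_eq_of_succ (S := fun i => altHarmonic (2 * i + 1) x)
    (fun i hi => by simpa [add_assoc] using hx (i + 2) (mem_Icc.2 (by omega)))
    (by simp [altHarmonic_one]) fun i hi => ?_
  have hdiff (k : ℕ) (hk : k ≤ i) :
      (x + k + 1) * (x + k + 2) * (1 / (x + (k + 1 : ℕ) + 1) - 1 / (x + k + 1)) = -1 * 1 := by
    have h1 : x + k + 1 ≠ 0 := by simpa [add_assoc] using hx (k + 1) (mem_Icc.2 (by omega))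
    have h2 : x + k + 2 ≠ 0 := by simpa [add_assoc] using hx (k + 2) (mem_Icc.2 (by omega))
    rw [show x + (k + 1 : ℕ) + 1 = x + k + 2 by push_cast; ring]
    field_simp
    ring
  have h2 : x + 2 * i + 2 ≠ 0 := by
    simpa [add_assoc] using hx (2 * i + 2) (mem_Icc.2 (by omega))
  have h3 : x + 2 * i + 3 ≠ 0 := by
    simpa [add_assoc] using hx (2 * i + 3) (mem_Icc.2 (by omega))
  rw [chooseConv_congr hdiff, chooseConv_const_mul, chooseConv_diagonal_one,
    altHarmonic_odd_succ]
  field_simp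
  ring

lemma chooseConv_diagonal_genHarmonicOrd_two (hx : ∀ j ∈ Icc 1 (2 * n + 1), x + j ≠ 0) :
    chooseConv n n x (fun k => genHarmonicOrd 2 k x)
      = Ring.choose (x + 2 * n + 1) n
        * ((genHarmonicOrd 2 (2 * n + 1) x - altHarmonic (2 * n + 1) x ^ 2) / 2) := by
  refine chooseConv_diagonal_eq_of_succ
    (S := fun i => (genHarmonicOrd 2 (2 * i + 1) x - altHarmonic (2 * i + 1) x ^ 2) / 2)
    (fun i hi => by simpa [add_assoc] using hx (i + 2) (mem_Icc.2 (by omega)))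
    (by simp [genHarmonicOrd, altHarmonic_one]) fun i hi => ?_
  have hdiff (k : ℕ) (hk : k ≤ i) :
      (x + k + 1) * (x + k + 2) * (genHarmonicOrd 2 (k + 1) x - genHarmonicOrd 2 k x)
        = 1 + 1 / (x + k + 1) := by
    have h1 : x + k + 1 ≠ 0 := by simpa [add_assoc] using hx (k + 1) (mem_Icc.2 (by omega))
    rw [genHarmonicOrd_succ]
    field_simp
    ring
  have h2 : x + 2 * i + 2 ≠ 0 := by
    simpa [add_assoc] using hx (2 * i + 2) (mem_Icc.2 (by omega))
  have h3 : x + 2 * i + 3 ≠ 0 := by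
    simpa [add_assoc] using hx (2 * i + 3) (mem_Icc.2 (by omega))
  rw [chooseConv_congr hdiff, chooseConv_add, chooseConv_diagonal_one,
    chooseConv_diagonal_one_div fun j hj => hx j (Icc_subset_Icc_right (by omega) hj),
    altHarmonic_odd_succ,
    show 2 * (i + 1) + 1 = 2 * i + 1 + 1 + 1 by ring, genHarmonicOrd_succ, genHarmonicOrd_succ,
    show x + (2 * i + 1 : ℕ) + 1 = x + 2 * i + 2 by push_cast; ring,
    show x + (2 * i + 1 + 1 : ℕ) + 1 = x + 2 * i + 3 by push_cast; ring]
  field_simp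
  ring

lemma chooseConv_diagonal_sq_mul_genHarmonicOrd_two (hx : ∀ j ∈ Icc 1 (2 * n + 1), x + j ≠ 0) :
    (x + n + 2) * (x + n + 3) * chooseConv n n x (fun k => (k : ℂ) ^ 2 * genHarmonicOrd 2 k x)
      = Ring.choose (x + 2 * n + 1) n
        * (n * (x + 1) * (x * n + 3 * n + 1)
              * ((genHarmonicOrd 2 (2 * n + 1) x - altHarmonic (2 * n + 1) x ^ 2) / 2)
            - (x + n + 1) * (x ^ 2 + 3 * x - 2 * n + 1) * altHarmonic (2 * n + 1) x
            + (x ^ 2 + 3 * x + n ^ 2 - n + 1)) := by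
  have hdivision (k : ℕ) (hk : k ≤ n) :
      ((n : ℂ) - k) * ((x + n + 2) * (k + 1) + n * (x + 2) - (x + 1))
          * ((x + k + 1) * (genHarmonicOrd 2 (k + 1) x - genHarmonicOrd 2 k x))
        = -((x + n + 1) * (x ^ 2 + 3 * x - 2 * n + 1)) * (1 / (x + k + 1))
          + ((x ^ 2 + 3 * x + x * n + n ^ 2 + 1) * 1 + -(x + n + 2) * k) := by
    have hk1 : x + k + 1 ≠ 0 := by simpa [add_assoc] using hx (k + 1) (mem_Icc.2 (by omega))
    rw [genHarmonicOrd_succ]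
    field_simp
    ring
  have hid := chooseConv_id n n x
  rw [chooseConv_sq_mul, chooseConv_congr hdivision, chooseConv_add, chooseConv_add,
    chooseConv_const_mul, chooseConv_const_mul, chooseConv_const_mul,
    chooseConv_diagonal_genHarmonicOrd_two hx, chooseConv_diagonal_one_div hx,
    chooseConv_diagonal_one]
  rw [chooseConv_diagonal_one] at hid
  linear_combination -hid

lemma chooseConv_diagonal_sq_mul_genHarmonicOrd_two_of_two_le (hn : 2 ≤ n)
    (hx : ∀ j ∈ Icc 1 (2 * n + 1), x + j ≠ 0) :
    n * ((n : ℂ) - 1) * chooseConv n n x (fun k => (k : ℂ) ^ 2 * genHarmonicOrd 2 k x)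
      = Ring.choose (x + 2 * n + 1) (n - 2)
        * (n * (x + 1) * (x * n + 3 * n + 1)
              * ((genHarmonicOrd 2 (2 * n + 1) x - altHarmonic (2 * n + 1) x ^ 2) / 2)
            - (x + n + 1) * (x ^ 2 + 3 * x - 2 * n + 1) * altHarmonic (2 * n + 1) x
            + (x ^ 2 + 3 * x + n ^ 2 - n + 1)) := by
  have h2 : x + n + 2 ≠ 0 := by simpa [add_assoc] using hx (n + 2) (mem_Icc.2 (by omega))
  have h3 : x + n + 3 ≠ 0 := by simpa [add_assoc] using hx (n + 3) (mem_Icc.2 (by omega))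
  apply mul_left_cancel₀ (mul_ne_zero h2 h3)
  rw [mul_left_comm, chooseConv_diagonal_sq_mul_genHarmonicOrd_two hx,
    ← mul_assoc _ (Ring.choose _ _), ← mul_assoc _ (Ring.choose _ _),
    ringChoose_two_mul_sub_two x hn]

end OrderTwo

section Derivatives

variable {x : ℂ}

lemma eventually_add_natCast_ne_zero {M : ℕ} (hx : ∀ j ∈ Icc 1 M, x + j ≠ 0) :
    ∀ᶠ z : ℂ in 𝓝 x, ∀ j ∈ Icc 1 M, z + j ≠ 0 :=
  (eventually_all_finset _).2 fun j hj =>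
    (continuous_add_const (j : ℂ)).continuousAt.eventually_ne (hx j hj)

lemma hasDerivAt_genHarmonicOrd (ℓ : ℕ) {n : ℕ} (hx : ∀ j ∈ Icc 1 n, x + j ≠ 0) :
    HasDerivAt (genHarmonicOrd ℓ n) (-ℓ * genHarmonicOrd (ℓ + 1) n x) x := by
  rw [genHarmonicOrd, mul_sum]
  refine HasDerivAt.fun_sum fun j hj => ?_
  have hpow := ((hasDerivAt_id x).add_const (j : ℂ)).fun_pow ℓ
  simp only [one_div]
  refine (hpow.fun_inv (pow_ne_zero ℓ (hx j hj))).congr_deriv ?_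
  have := hx j hj
  rcases ℓ with _ | ℓ
  · simp
  · simp only [id, Nat.add_sub_cancel]
    field_simp
    ring

lemma hasDerivAt_ringChoose_add {a b : ℕ} (hx : ∀ j ∈ Icc (a + 1) (a + b), x + j ≠ 0) :
    HasDerivAt (fun z : ℂ => Ring.choose (z + (a + b : ℕ)) b)
      (Ring.choose (x + (a + b : ℕ)) b * (genHarmonic (a + b) x - genHarmonic a x)) x := by
  induction b with
  | zero => simpa using hasDerivAt_const x (1 : ℂ)
  | succ b ih =>
    have hb : (b : ℂ) + 1 ≠ 0 := Nat.cast_add_one_ne_zero b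
    have hne : x + a + b + 1 ≠ 0 := by
      simpa [add_assoc] using hx (a + b + 1) (mem_Icc.2 (by omega))
    have hstep (z : ℂ) : Ring.choose (z + (a + (b + 1) : ℕ)) (b + 1)
        = (z + (a + b + 1)) / (b + 1) * Ring.choose (z + (a + b : ℕ)) b := by
      rw [div_mul_eq_mul_div, eq_div_iff hb, mul_comm]
      simpa [add_assoc] using succ_mul_ringChoose_add_succ (z + a) b
    simp only [hstep]
    refine ((((hasDerivAt_id x).add_const (a + b + 1 : ℂ)).div_const (b + 1 : ℂ)).mul
      (ih fun j hj => hx j (Icc_subset_Icc_right (by omega) hj))).congr_deriv ?_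
    rw [← add_assoc a b 1, genHarmonic_succ, Nat.cast_add a b, ← add_assoc x, id]
    field_simp
    ring

lemma hasDerivAt_ringChoose_add_mul_sub {a b : ℕ} (hx : ∀ j ∈ Icc 1 (a + b), x + j ≠ 0) :
    HasDerivAt
      (fun z : ℂ => Ring.choose (z + (a + b : ℕ)) b * (genHarmonic (a + b) z - genHarmonic a z))
      (Ring.choose (x + (a + b : ℕ)) b * ((genHarmonic (a + b) x - genHarmonic a x) ^ 2
        - (genHarmonicOrd 2 (a + b) x - genHarmonicOrd 2 a x))) x := by
  have hchoose := hasDerivAt_ringChoose_add (x := x) (a := a) (b := b) fun j hj =>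
    hx j (Icc_subset_Icc_left (by omega) hj)
  have hab := hasDerivAt_genHarmonicOrd 1 hx
  have ha := hasDerivAt_genHarmonicOrd 1 (x := x) (n := a) fun j hj =>
    hx j (Icc_subset_Icc_right (by omega) hj)
  refine (hchoose.mul (hab.sub ha)).congr_deriv ?_
  simp only [genHarmonic, Pi.sub_apply]
  push_cast
  ring

lemma hasDerivAt_chooseConv (m : ℕ) {N : ℕ} (hx : ∀ j ∈ Icc 1 N, x + j ≠ 0) (g : ℕ → ℂ) :
    HasDerivAt (fun z => chooseConv m N z g)
      (chooseConv m N x fun k => g k * genHarmonic k x) x := by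
  refine HasDerivAt.fun_sum fun k hk => ?_
  have hchoose := hasDerivAt_ringChoose_add (a := 0) (b := k) fun j hj =>
    hx j (Icc_subset_Icc_right ((zero_add k).trans_le (mem_range_succ_iff.1 hk)) hj)
  simp only [zero_add, genHarmonic_zero, sub_zero] at hchoose
  refine ((hchoose.const_mul ((m + N - k).choose m : ℂ)).mul_const (g k)).congr_deriv ?_
  rw [chooseWeight]
  ring

lemma hasDerivAt_chooseConv_mul_genHarmonic (m : ℕ) {N : ℕ} (hx : ∀ j ∈ Icc 1 N, x + j ≠ 0)
    (g : ℕ → ℂ) :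
    HasDerivAt (fun z => chooseConv m N z fun k => g k * genHarmonic k z)
      (chooseConv m N x fun k => g k * (genHarmonic k x ^ 2 - genHarmonicOrd 2 k x)) x := by
  refine HasDerivAt.fun_sum fun k hk => ?_
  have hchoose := hasDerivAt_ringChoose_add_mul_sub (a := 0) (b := k) fun j hj =>
    hx j (Icc_subset_Icc_right ((zero_add k).trans_le (mem_range_succ_iff.1 hk)) hj)
  simp only [zero_add, genHarmonic_zero, genHarmonicOrd_zero, sub_zero] at hchoose
  have h := (hchoose.const_mul ((m + N - k).choose m : ℂ)).mul_const (g k)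
  refine (h.congr_deriv ?_).congr_of_eventuallyEq (.of_eq (funext fun z => ?_)) <;>
    · rw [chooseWeight]
      ring

lemma hasDerivAt_quadratic_factor (x : ℂ) (n : ℕ) :
    HasDerivAt (fun z : ℂ => (z + 1) * (z * n + 3 * n + 1)) (2 * x * n + 4 * n + 1) x := by
  refine (((hasDerivAt_id x).add_const 1).mul ((((hasDerivAt_id x).mul_const (n : ℂ)).add_const
    (3 * n : ℂ)).add_const 1)).congr_deriv ?_
  simp only [id]
  ring

end Derivatives

section SquaredHarmonic

variable {x : ℂ} {n : ℕ}

lemma hasDerivAt_ringChoose_two_mul (hn : 2 ≤ n) (hx : ∀ j ∈ Icc (n + 4) (2 * n + 1), x + j ≠ 0) :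
    HasDerivAt (fun z : ℂ => Ring.choose (z + 2 * n + 1) (n - 2))
      (Ring.choose (x + 2 * n + 1) (n - 2)
        * (genHarmonic (2 * n + 1) x - genHarmonic (n + 3) x)) x := by
  have hsplit : n + 3 + (n - 2) = 2 * n + 1 := by omega
  simpa [hsplit, add_assoc] using
    hasDerivAt_ringChoose_add (a := n + 3) (b := n - 2) (by rwa [hsplit])

lemma hasDerivAt_ringChoose_two_mul_mul_sub (hn : 2 ≤ n)
    (hx : ∀ j ∈ Icc 1 (2 * n + 1), x + j ≠ 0) :
    HasDerivAt (fun z : ℂ => Ring.choose (z + 2 * n + 1) (n - 2)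
        * (genHarmonic (2 * n + 1) z - genHarmonic (n + 3) z))
      (Ring.choose (x + 2 * n + 1) (n - 2)
        * ((genHarmonic (2 * n + 1) x - genHarmonic (n + 3) x) ^ 2
          - (genHarmonicOrd 2 (2 * n + 1) x - genHarmonicOrd 2 (n + 3) x))) x := by
  have hsplit : n + 3 + (n - 2) = 2 * n + 1 := by omega
  simpa [hsplit, add_assoc] using
    hasDerivAt_ringChoose_add_mul_sub (a := n + 3) (b := n - 2) (by rwa [hsplit])

lemma chooseConv_diagonal_sq_mul_genHarmonic (hn : 2 ≤ n)
    (hx : ∀ j ∈ Icc 1 (2 * n + 1), x + j ≠ 0) :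
    ((n : ℂ) - 1) * chooseConv n n x (fun k => (k : ℂ) ^ 2 * genHarmonic k x)
      = Ring.choose (x + 2 * n + 1) (n - 2)
          * (genHarmonic (2 * n + 1) x - genHarmonic (n + 3) x)
          * ((x + 1) * (x * n + 3 * n + 1))
        + Ring.choose (x + 2 * n + 1) (n - 2) * (2 * x * n + 4 * n + 1) := by
  have hclosed : ∀ᶠ z : ℂ in 𝓝 x, ((n : ℂ) - 1) * chooseConv n n z (fun k => (k : ℂ) ^ 2)
      = Ring.choose (z + 2 * n + 1) (n - 2) * ((z + 1) * (z * n + 3 * n + 1)) := by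
    filter_upwards [eventually_add_natCast_ne_zero hx] with z hz
    exact chooseConv_diagonal_sq hn
      (by simpa [add_assoc] using hz (n + 2) (mem_Icc.2 (by omega)))
      (by simpa [add_assoc] using hz (n + 3) (mem_Icc.2 (by omega)))
  have hleft := (hasDerivAt_chooseConv (x := x) (N := n) n
    (fun j hj => hx j (Icc_subset_Icc_right (by omega) hj))
    fun k => (k : ℂ) ^ 2).const_mul ((n : ℂ) - 1)
  have hright := (hasDerivAt_ringChoose_two_mul hn fun j hj =>
    hx j (Icc_subset_Icc_left (by omega) hj)).mul (hasDerivAt_quadratic_factor x n)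
  exact hleft.unique (hright.congr_of_eventuallyEq hclosed)

lemma chooseConv_diagonal_sq_mul_genHarmonic_sq_sub (hn : 2 ≤ n)
    (hx : ∀ j ∈ Icc 1 (2 * n + 1), x + j ≠ 0) :
    ((n : ℂ) - 1) * chooseConv n n x
        (fun k => (k : ℂ) ^ 2 * (genHarmonic k x ^ 2 - genHarmonicOrd 2 k x))
      = Ring.choose (x + 2 * n + 1) (n - 2)
        * ((x + 1) * (x * n + 3 * n + 1)
            * ((genHarmonic (2 * n + 1) x - genHarmonic (n + 3) x) ^ 2
              - (genHarmonicOrd 2 (2 * n + 1) x - genHarmonicOrd 2 (n + 3) x))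
          + 2 * (2 * x * n + 4 * n + 1) * (genHarmonic (2 * n + 1) x - genHarmonic (n + 3) x)
          + 2 * n) := by
  have hleft := (hasDerivAt_chooseConv_mul_genHarmonic (x := x) (N := n) n
    (fun j hj => hx j (Icc_subset_Icc_right (by omega) hj))
    fun k => (k : ℂ) ^ 2).const_mul ((n : ℂ) - 1)
  have hlinear : HasDerivAt (fun z : ℂ => 2 * z * n + 4 * n + 1) (2 * n : ℂ) x := by
    simpa using ((((hasDerivAt_id x).const_mul 2).mul_const (n : ℂ)).add_const
      (4 * n : ℂ)).add_const 1
  have hright := ((hasDerivAt_ringChoose_two_mul_mul_sub hn hx).mul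
    (hasDerivAt_quadratic_factor x n)).add ((hasDerivAt_ringChoose_two_mul hn fun j hj =>
      hx j (Icc_subset_Icc_left (by omega) hj)).mul hlinear)
  have hclosed := (eventually_add_natCast_ne_zero hx).mono fun z hz =>
    chooseConv_diagonal_sq_mul_genHarmonic hn hz
  refine (hleft.unique (hright.congr_of_eventuallyEq hclosed)).trans ?_
  ring

end SquaredHarmonic

theorem theorem9 (n : ℕ) (hn : 2 ≤ n) (x : ℂ)
    (hx : ∀ j ∈ Finset.Icc 1 (2 * n + 1), x ≠ -(j : ℂ))
    (hxn : x * n + 3 * n + 1 ≠ 0) :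
    ∑ k ∈ Finset.range (n + 1),
        ((2 * n - k).choose n : ℂ) * Ring.choose (x + (k : ℂ)) k * (k : ℂ) ^ 2
          * genHarmonic k x ^ 2 =
      (x + 1) * (x * n + 3 * n + 1) / (8 * ((n : ℂ) - 1))
        * Ring.choose (x + 2 * (n : ℂ) + 1) (n - 2)
        * (8 * (genHarmonic (n + 3) x - genHarmonic (2 * n + 1) x)
              * (genHarmonic (n + 3) x - genHarmonic (2 * n + 1) x
                  - 2 * (2 * x * n + 4 * n + 1) / ((x + 1) * (x * n + 3 * n + 1)))
            - (genHarmonic n (x / 2) - genHarmonic (n + 1) ((x - 1) / 2))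
              * (genHarmonic n (x / 2) - genHarmonic (n + 1) ((x - 1) / 2)
                  - 4 * (x + n + 1) * (x ^ 2 + 3 * x - 2 * n + 1)
                    / (n * (x + 1) * (x * n + 3 * n + 1)))
            + 8 * genHarmonicOrd 2 (n + 3) x - 4 * genHarmonicOrd 2 (2 * n + 1) x
            + 8 * (x ^ 2 + 3 * x + 3 * (n : ℂ) ^ 2 - n + 1)
                / (n * (x + 1) * (x * n + 3 * n + 1))) := by
  have hx' (j) (hj : j ∈ Icc 1 (2 * n + 1)) : x + (j : ℂ) ≠ 0 := fun h =>
    hx j hj (eq_neg_of_add_eq_zero_left h)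
  have hn0 : (n : ℂ) ≠ 0 := by exact_mod_cast (by omega : n ≠ 0)
  have hn1 : (n : ℂ) - 1 ≠ 0 := sub_ne_zero.2 (by exact_mod_cast (by omega : n ≠ 1))
  have hx1 : x + 1 ≠ 0 := by simpa using hx' 1 (mem_Icc.2 (by omega))
  have hsplit : ∑ k ∈ range (n + 1),
        ((2 * n - k).choose n : ℂ) * Ring.choose (x + (k : ℂ)) k * (k : ℂ) ^ 2
          * genHarmonic k x ^ 2
      = chooseConv n n x (fun k => (k : ℂ) ^ 2 * (genHarmonic k x ^ 2 - genHarmonicOrd 2 k x))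
        + chooseConv n n x (fun k => (k : ℂ) ^ 2 * genHarmonicOrd 2 k x) := by
    rw [← chooseConv_add, two_mul]
    exact sum_congr rfl fun k _ => by rw [chooseWeight]; ring
  rw [hsplit, genHarmonic_half_sub_genHarmonic_half,
    (eq_inv_mul_iff_mul_eq₀ hn1).2 (chooseConv_diagonal_sq_mul_genHarmonic_sq_sub hn hx'),
    (eq_inv_mul_iff_mul_eq₀ (mul_ne_zero hn0 hn1)).2
      (chooseConv_diagonal_sq_mul_genHarmonicOrd_two_of_two_le hn hx')]
  generalize Ring.choose (x + 2 * n + 1) (n - 2) = c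
  generalize hq : x * (n : ℂ) + 3 * n + 1 = q at hxn ⊢
  field_simp
  rw [← hq]
  ring
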